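/- A $k$-uniform hypergraph is a family of $k$-element subsets (edges) of a finite vertex set. For $k$-uniform hypergraphs $\mathcal{G}$ and $\mathcal{H}$ write $\mathcal{H}\to(\mathcal{G})_r$ if every colouring of the edges of $\mathcal{H}$ with $r$ colours contains a monochromatic copy of $\mathcal{G}$, and let $\hat R(\mathcal{G},r)=\min\{|E(\mathcal{H})| : \mathcal{H}\to(\mathcal{G})_r\}$ be the $r$-colour size-Ramsey number of $\mathcal{G}$. Let $\mathcal{P}^{(k)}_{n,k-1}$ be the $k$-uniform tight path on $n$ vertices, that is, the hypergraph with vertex set $\{1,\dots,n\}$ whose edges are the sets $\{i,i+1,\dots,i+k-1\}$ for $1\le i\le n-k+1$. **Theorem.** For every $k\ge 3$ there is a constant $C=C(k)>0$ such that for every $r\ge 2$ there is an $n_0=n_0(k,r)$ with \[\hat R\left(\mathcal{P}^{(k)}_{n,k-1},r\right)\le C\,r^{k}\,(n\log n)^{k/2}\qquad\text{for all } n\ge n_0,\] where $\log$ is the natural logarithm. -/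

import Mathlib

/-- A `k`-uniform hypergraph on the vertex set `V`: a finite family of `k`-element subsets of `V`. -/
structure UniformHypergraph (k : ℕ) (V : Type*) where
  edges : Finset (Finset V)
  uniform : ∀ e ∈ edges, e.card = k

namespace UniformHypergraph

/-- The `r`-edge-colouring `c` of `H` has a monochromatic copy of `G`: an injection of the vertices
of `G` into those of `H` that maps all edges of `G` to edges of `H` of one and the same colour. -/
def HasMonoCopy {k r : ℕ} {V W : Type*} (H : UniformHypergraph k V) (G : UniformHypergraph k W)
    (c : {e // e ∈ H.edges} → Fin r) : Prop :=
  ∃ (i : Fin r) (f : W ↪ V), ∀ e ∈ G.edges, ∃ he : e.map f ∈ H.edges, c ⟨e.map f, he⟩ = i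

/-- `H → (G)_r`: every `r`-edge-colouring of `H` has a monochromatic copy of `G`. -/
def Arrows {k : ℕ} {V W : Type*} (H : UniformHypergraph k V) (G : UniformHypergraph k W)
    (r : ℕ) : Prop :=
  ∀ c : {e // e ∈ H.edges} → Fin r, H.HasMonoCopy G c

/-- The `r`-colour size-Ramsey number of `G`: the least number of edges of a finite `k`-uniform
hypergraph `H` with `H → (G)_r` (it would be `⊤` if there were no such `H`). -/
noncomputable def sizeRamsey {k : ℕ} {W : Type*} (G : UniformHypergraph k W) (r : ℕ) : ℕ∞ :=
  sInf {m : ℕ∞ | ∃ (V : Type) (_ : Fintype V) (H : UniformHypergraph k V),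
    H.Arrows G r ∧ m = (H.edges.card : ℕ∞)}

/-- The `k`-uniform tight path on the `n` vertices `0, …, n - 1`: its edges are the `n - k + 1`
intervals `{i, …, i + k - 1}` with `i + k ≤ n` (none if `n < k`). -/
def tightPath (k n : ℕ) : UniformHypergraph k (Fin n) where
  edges := (Finset.range (n + 1 - k)).image
    fun i => Finset.univ.filter fun j : Fin n => i ≤ (j : ℕ) ∧ (j : ℕ) < i + k
  uniform := by
    intro e he
    obtain ⟨i, hi, rfl⟩ := Finset.mem_image.mp he
    have hi' : i + k ≤ n := by
      have := Finset.mem_range.mp hi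
      omega
    rw [← Finset.card_map Fin.valEmbedding]
    have h : (Finset.univ.filter fun j : Fin n => i ≤ (j : ℕ) ∧ (j : ℕ) < i + k).map
        Fin.valEmbedding = Finset.Ico i (i + k) := by
      ext x
      simp only [Finset.mem_map, Finset.mem_filter, Finset.mem_univ, true_and,
        Fin.valEmbedding_apply, Finset.mem_Ico]
      constructor
      · rintro ⟨j, hj, rfl⟩
        exact hj
      · intro hx
        exact ⟨⟨x, by omega⟩, hx, rfl⟩
    rw [h, Nat.card_Ico]
    omega

end UniformHypergraph

namespace UniformHypergraph

open Finset
open scoped FinsetFamily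

/-! ### Pruning by degree, and tight paths in set families. -/

section Deterministic

variable {V : Type*} [DecidableEq V]

/-- A uniform family that is large compared with its shadow contains a nonempty subfamily in which
every set of the shadow has large degree. -/
theorem exists_subfamily_degree_ge {s d : ℕ} {F : Finset (Finset V)} (hF : ∀ e ∈ F, #e = s + 1)
    (h : d * #(∂ F) < #F) :
    ∃ F' ⊆ F, F'.Nonempty ∧ ∀ S ∈ ∂ F', d ≤ #{e ∈ F' | S ⊆ e} := by
  induction hm : #F using Nat.strong_induction_on generalizing F with
  | _ m ih =>
    by_cases hgood : ∀ S ∈ ∂ F, d ≤ #{e ∈ F | S ⊆ e}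
    · exact ⟨F, Subset.rfl, card_pos.1 (by omega), hgood⟩
    · push Not at hgood
      obtain ⟨S, hS, hlt⟩ := hgood
      have hsplit : #{e ∈ F | S ⊆ e} + #{e ∈ F | ¬ S ⊆ e} = #F :=
        card_filter_add_card_filter_not _
      have hSF : 0 < #{e ∈ F | S ⊆ e} := by
        obtain ⟨e, he, hSe, -⟩ := mem_shadow_iff_exists_mem_card_add_one.1 hS
        exact card_pos.2 ⟨e, by simp [he, hSe]⟩
      have hsh : ∂ {e ∈ F | ¬ S ⊆ e} ⊆ (∂ F).erase S := by
        intro S' hS'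
        refine mem_erase.2 ⟨?_, shadow_mono (filter_subset _ _) hS'⟩
        rintro rfl
        obtain ⟨e, he, hSe, -⟩ := mem_shadow_iff_exists_mem_card_add_one.1 hS'
        exact (mem_filter.1 he).2 hSe
      have hcard : #(∂ {e ∈ F | ¬ S ⊆ e}) + 1 ≤ #(∂ F) := by
        have h1 := card_le_card hsh
        have h2 := card_erase_add_one hS
        omega
      have hmul : d * #(∂ {e ∈ F | ¬ S ⊆ e}) + d ≤ d * #(∂ F) := by
        calc _ = d * (#(∂ {e ∈ F | ¬ S ⊆ e}) + 1) := by ring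
          _ ≤ _ := Nat.mul_le_mul_left _ hcard
      -- Deleting the sets through S loses fewer than d sets and at least one shadow element, so the
      -- strict inequality survives; it also keeps the family nonempty.
      obtain ⟨F', hF', hne, hdeg⟩ := ih _ (by omega) (F := {e ∈ F | ¬ S ⊆ e})
        (fun e he => hF e (mem_filter.1 he).1) (by omega) rfl
      exact ⟨F', hF'.trans (filter_subset _ _), hne, hdeg⟩

/-- A tight path `P 0, …, P (l - 1)` in the family `F` of `(s + 1)`-sets, all of whose `s`-windows
lie in the shadow of `F`. -/
structure IsTightPathIn (s : ℕ) (F : Finset (Finset V)) (P : ℕ → V) (l : ℕ) : Prop where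
  injOn : Set.InjOn P (range l : Set ℕ)
  window_mem : ∀ j, j + (s + 1) ≤ l → (Ico j (j + (s + 1))).image P ∈ F
  shadow_mem : ∀ j, j + s ≤ l → (Ico j (j + s)).image P ∈ ∂ F

theorem IsTightPathIn.mono {s : ℕ} {F : Finset (Finset V)} {P : ℕ → V} {l l' : ℕ}
    (h : IsTightPathIn s F P l) (hl : l' ≤ l) : IsTightPathIn s F P l' where
  injOn := h.injOn.mono (by exact_mod_cast range_mono hl)
  window_mem j hj := h.window_mem j (hj.trans hl)
  shadow_mem j hj := h.shadow_mem j (hj.trans hl)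

theorem IsTightPathIn.card_window {s : ℕ} {F : Finset (Finset V)} {P : ℕ → V} {l j m : ℕ}
    (h : IsTightPathIn s F P l) (hj : j + m ≤ l) : #((Ico j (j + m)).image P) = m := by
  rw [card_image_of_injOn, Nat.card_Ico]
  · omega
  · refine h.injOn.mono fun x hx => ?_
    simp only [coe_Ico, Set.mem_Ico] at hx
    simp only [coe_range, Set.mem_Iio]
    omega

theorem exists_isTightPathIn {s : ℕ} {F : Finset (Finset V)} (hF : ∀ e ∈ F, #e = s + 1)
    (hne : F.Nonempty) : ∃ P : ℕ → V, IsTightPathIn s F P s := by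
  obtain ⟨e, he⟩ := hne
  obtain ⟨v, hv⟩ := card_pos.1 (show 0 < #e by rw [hF e he]; omega)
  have hcard : #(e.erase v) = s := by rw [card_erase_of_mem hv, hF e he]; rfl
  let E := (e.erase v).equivFinOfCardEq hcard
  let P : ℕ → V := fun j => if h : j < s then E.symm ⟨j, h⟩ else v
  have hP : ∀ j (h : j < s), P j = E.symm ⟨j, h⟩ := fun j h => dif_pos h
  have hinj : Set.InjOn P (range s : Set ℕ) := by
    intro a ha b hb hab
    simp only [coe_range, Set.mem_Iio] at ha hb
    rw [hP a ha, hP b hb] at hab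
    simpa using E.symm.injective (Subtype.ext hab)
  refine ⟨P, hinj, fun j hj => by omega, fun j hj => ?_⟩
  obtain rfl : j = 0 := by omega
  have : (Ico 0 (0 + s)).image P = e.erase v := by
    refine eq_of_subset_of_card_le ?_ ?_
    · intro x hx
      obtain ⟨a, ha, rfl⟩ := mem_image.1 hx
      rw [hP a (by simpa using ha)]
      exact (E.symm _).2
    · rw [hcard, zero_add, ← range_eq_Ico, card_image_of_injOn hinj, card_range]
  rw [this]
  exact erase_mem_shadow he hv

theorem IsTightPathIn.extend {s : ℕ} {F : Finset (Finset V)} {P : ℕ → V} {l : ℕ}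
    (h : IsTightPathIn s F P l) (hF : ∀ e ∈ F, #e = s + 1) (hs : 0 < s) (hl : s ≤ l) {w : V}
    (hw : w ∉ (range l).image P) (hwF : insert w ((Ico (l - s) l).image P) ∈ F) :
    IsTightPathIn s F (Function.update P l w) (l + 1) := by
  have himg : ∀ a b, b ≤ l → (Ico a b).image (Function.update P l w) = (Ico a b).image P := by
    intro a b hb
    refine image_congr fun x hx => ?_
    simp only [coe_Ico, Set.mem_Ico] at hx
    exact Function.update_of_ne (by omega) _ _
  have hinj : Set.InjOn (Function.update P l w) (range (l + 1) : Set ℕ) := by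
    have hne : ∀ a < l, P a ≠ w := fun a ha hPa =>
      hw (mem_image.2 ⟨a, mem_range.2 ha, hPa⟩)
    intro a ha b hb hab
    simp only [coe_range, Set.mem_Iio] at ha hb
    rcases Nat.lt_succ_iff_lt_or_eq.1 ha with ha | rfl <;>
      rcases Nat.lt_succ_iff_lt_or_eq.1 hb with hb | rfl
    · rw [Function.update_of_ne (by omega), Function.update_of_ne (by omega)] at hab
      exact h.injOn (by simpa using ha) (by simpa using hb) hab
    · rw [Function.update_of_ne (by omega), Function.update_self] at hab
      exact absurd hab (hne a ha)
    · rw [Function.update_of_ne (a := b) (by omega), Function.update_self] at hab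
      exact absurd hab.symm (hne b hb)
    · rfl
  have hlast : ∀ j, j ≤ l → (Ico j (l + 1)).image (Function.update P l w) =
      insert w ((Ico j l).image P) := by
    intro j hj
    rw [← insert_Ico_right_eq_Ico_add_one hj, image_insert, Function.update_self, himg _ _ le_rfl]
  refine ⟨hinj, fun j hj => ?_, fun j hj => ?_⟩
  · rcases hj.lt_or_eq with hj | hj
    · rw [himg _ _ (by omega)]
      exact h.window_mem j (by omega)
    · rw [hj, hlast _ (by omega)]
      rwa [show j = l - s by omega]
  · rcases hj.lt_or_eq with hj | hj
    · rw [himg _ _ (by omega)]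
      exact h.shadow_mem j (by omega)
    · rw [hj, mem_shadow_iff_exists_mem_card_add_one]
      refine ⟨_, hwF, ?_, ?_⟩
      · rw [hlast _ (by omega)]
        exact insert_subset_insert _ (image_subset_image (Ico_subset_Ico_left (by omega)))
      · rw [hF _ hwF, card_image_of_injOn, Nat.card_Ico]
        · omega
        · refine hinj.mono fun x hx => ?_
          simp only [coe_Ico, Set.mem_Ico] at hx
          simp only [coe_range, Set.mem_Iio]
          omega

/-! ### Cliques, common neighbours and saturated families. -/

variable [Fintype V]

/-- The common neighbours of all the vertices of `S`. -/
def commonNbrs (G : SimpleGraph V) [DecidableRel G.Adj] (S : Finset V) : Finset V :=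
  {w | ∀ v ∈ S, G.Adj v w}

variable {G : SimpleGraph V} [DecidableRel G.Adj]

theorem mem_commonNbrs {S : Finset V} {w : V} :
    w ∈ commonNbrs G S ↔ ∀ v ∈ S, G.Adj v w := by
  simp [commonNbrs]

theorem notMem_of_mem_commonNbrs {S : Finset V} {w : V} (hw : w ∈ commonNbrs G S) : w ∉ S :=
  fun h => G.loopless.irrefl w (mem_commonNbrs.1 hw w h)

/-- Greedy: the clique is padded to an s-set in W, and a common neighbour of that set extends it.
This keeps the double count in `exists_mono_family` from being vacuous. -/
theorem exists_isNClique_subset {W : Finset V} {s m : ℕ} (hm : 0 < m) (hsW : s ≤ #W)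
    (hW : ∀ S ⊆ W, #S = s → m ≤ #(commonNbrs G S ∩ W)) {j : ℕ} (hj : j ≤ s) :
    ∃ S ⊆ W, G.IsNClique j S := by
  induction j with
  | zero => exact ⟨∅, by simp, by simp⟩
  | succ j ih =>
    obtain ⟨S, hS, hc⟩ := ih (by omega)
    obtain ⟨S', hSS', hS'W, hcard⟩ := exists_subsuperset_card_eq hS
      (by rw [hc.card_eq]; omega) hsW
    obtain ⟨w, hw⟩ := card_pos.1 (hm.trans_le (hW S' hS'W hcard))
    obtain ⟨hw1, hw2⟩ := mem_inter.1 hw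
    refine ⟨insert w S, insert_subset hw2 hS, hc.insert fun b hb => ?_⟩
    exact (mem_commonNbrs.1 hw1 b (hSS' hb)).symm

/-- If all `s`-sets in `W` have many common neighbours in `W`, every colouring of the
`(s + 1)`-cliques has a nonempty monochromatic family of cliques in `W` with large codegrees. -/
theorem exists_mono_family {W : Finset V} {s m d r : ℕ} (hm : (s + 1) * (r * d) < m)
    (hsW : s ≤ #W) (hW : ∀ S ⊆ W, #S = s → m ≤ #(commonNbrs G S ∩ W)) (c : Finset V → Fin r) :
    ∃ (i : Fin r) (F : Finset (Finset V)), F.Nonempty ∧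
      (∀ e ∈ F, e ∈ G.cliqueFinset (s + 1) ∧ e ⊆ W ∧ c e = i) ∧
      ∀ S ∈ ∂ F, d ≤ #{e ∈ F | S ⊆ e} := by
  by_contra hcon
  push Not at hcon
  set K : Finset (Finset V) := {e ∈ G.cliqueFinset (s + 1) | e ⊆ W} with hK
  set L : Finset (Finset V) := {S ∈ G.cliqueFinset s | S ⊆ W} with hL
  -- If no colour class can be pruned, each has at most d sets per shadow element, and these
  -- elements are s-cliques in W.
  have hcol : ∀ i : Fin r, #{e ∈ K | c e = i} ≤ d * #L := by
    intro i
    have hmem : ∀ e ∈ ({e ∈ K | c e = i} : Finset _),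
        e ∈ G.cliqueFinset (s + 1) ∧ e ⊆ W ∧ c e = i := by
      intro e he
      simp only [hK, mem_filter] at he
      tauto
    have hle : #{e ∈ K | c e = i} ≤ d * #(∂ {e ∈ K | c e = i}) := by
      by_contra hlt
      obtain ⟨F', hF', hne, hdeg⟩ := exists_subfamily_degree_ge (s := s)
        (fun e he => (SimpleGraph.mem_cliqueFinset_iff.1 (hmem e he).1).card_eq) (not_le.1 hlt)
      obtain ⟨S, hS, hS'⟩ := hcon i F' hne (fun e he => hmem e (hF' he))
      exact absurd (hdeg S hS) (not_le.2 hS')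
    refine hle.trans (Nat.mul_le_mul_left _ (card_le_card ?_))
    intro S hS
    obtain ⟨e, he, hSe, hcard⟩ := mem_shadow_iff_exists_mem_card_add_one.1 hS
    obtain ⟨he1, he2, -⟩ := hmem e he
    have he1 := SimpleGraph.mem_cliqueFinset_iff.1 he1
    refine mem_filter.2 ⟨SimpleGraph.mem_cliqueFinset_iff.2 ⟨?_, ?_⟩, hSe.trans he2⟩
    · exact he1.isClique.subset (by exact_mod_cast hSe)
    · have := he1.card_eq
      omega
  have hKle : #K ≤ r * (d * #L) := by
    rw [card_eq_sum_card_fiberwise (f := c) (t := univ) (by simp)]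
    calc _ ≤ ∑ _i : Fin r, d * #L := sum_le_sum fun i _ => hcol i
      _ = _ := by simp
  -- Pairs S ⊆ e are counted twice: each S lies in at least m cliques of K, each e contains at most
  -- s + 1 members of L.
  have hdc : ∑ S ∈ L, #(K.bipartiteAbove (· ⊆ ·) S) = ∑ e ∈ K, #(L.bipartiteBelow (· ⊆ ·) e) :=
    sum_card_bipartiteAbove_eq_sum_card_bipartiteBelow _
  have hlow : #L * m ≤ ∑ S ∈ L, #(K.bipartiteAbove (· ⊆ ·) S) := by
    rw [← smul_eq_mul]
    refine card_nsmul_le_sum _ _ _ fun S hS => ?_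
    obtain ⟨hS1, hS2⟩ := mem_filter.1 hS
    have hS1 := SimpleGraph.mem_cliqueFinset_iff.1 hS1
    refine (hW S hS2 hS1.card_eq).trans (card_le_card_of_injOn (fun w => insert w S) ?_ ?_)
    · intro w hw
      obtain ⟨hw1, hw2⟩ := mem_inter.1 hw
      simp only [bipartiteAbove, coe_filter, Set.mem_ofPred_eq, hK, mem_filter,
        SimpleGraph.mem_cliqueFinset_iff]
      exact ⟨⟨hS1.insert fun b hb => (mem_commonNbrs.1 hw1 b hb).symm,
        insert_subset hw2 hS2⟩, subset_insert _ _⟩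
    · intro w hw w' hw' heq
      have h1 := notMem_of_mem_commonNbrs (mem_inter.1 hw).1
      have h2 : w ∈ insert w' S := (show insert w S = insert w' S from heq) ▸ mem_insert_self w S
      exact (mem_insert.1 h2).resolve_right h1
  have hup : ∑ e ∈ K, #(L.bipartiteBelow (· ⊆ ·) e) ≤ #K * (s + 1) := by
    rw [← smul_eq_mul]
    refine sum_le_card_nsmul _ _ _ fun e he => ?_
    have he1 := SimpleGraph.mem_cliqueFinset_iff.1 (mem_filter.1 he).1
    calc _ ≤ #(e.powersetCard s) := by
          refine card_le_card fun S hS => ?_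
          simp only [bipartiteBelow, hL, mem_filter, SimpleGraph.mem_cliqueFinset_iff] at hS
          exact mem_powersetCard.2 ⟨hS.2, hS.1.1.card_eq⟩
      _ = s + 1 := by rw [card_powersetCard, he1.card_eq, Nat.choose_succ_self_right]
  obtain ⟨S, hS, hSc⟩ := exists_isNClique_subset (by omega) hsW hW le_rfl
  have hLpos : 0 < #L := card_pos.2 ⟨S, mem_filter.2
    ⟨SimpleGraph.mem_cliqueFinset_iff.2 hSc, hS⟩⟩
  have : #L * m ≤ #L * ((s + 1) * (r * d)) := by
    calc _ ≤ #K * (s + 1) := hlow.trans (hdc.le.trans hup)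
      _ ≤ (r * (d * #L)) * (s + 1) := Nat.mul_le_mul_right _ hKle
      _ = _ := by ring
  exact absurd (Nat.le_of_mul_le_mul_left this hLpos) (not_le.2 hm)

/-- `T` consists of pairwise disjoint `s`-subsets of `A`, each of which has at least `d` common
neighbours in `B`. -/
structure IsSaturated (G : SimpleGraph V) [DecidableRel G.Adj] (s d : ℕ)
    (T : Finset (Finset V)) (A B : Finset V) : Prop where
  card_eq : ∀ S ∈ T, #S = s
  subset : ∀ S ∈ T, S ⊆ A
  le_card : ∀ S ∈ T, d ≤ #(commonNbrs G S ∩ B)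
  disjoint : ∀ S ∈ T, ∀ S' ∈ T, S ≠ S' → Disjoint S S'

theorem IsSaturated.mono {s d : ℕ} {T : Finset (Finset V)} {A A' B B' : Finset V}
    (h : IsSaturated G s d T A B) (hA : A ⊆ A') (hB : B ⊆ B') : IsSaturated G s d T A' B' where
  card_eq := h.card_eq
  subset S hS := (h.subset S hS).trans hA
  le_card S hS := (h.le_card S hS).trans (card_le_card (inter_subset_inter_left hB))
  disjoint := h.disjoint

theorem IsSaturated.insert {s d : ℕ} {T : Finset (Finset V)} {A B S : Finset V}
    (h : IsSaturated G s d T A B) (hS : #S = s) (hSA : Disjoint S A)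
    (hd : d ≤ #(commonNbrs G S ∩ B)) : IsSaturated G s d (insert S T) (A ∪ S) B where
  card_eq := by
    simpa [hS] using h.card_eq
  subset := by
    simp only [mem_insert, forall_eq_or_imp, subset_union_right, true_and]
    exact fun S' hS' => (h.subset S' hS').trans subset_union_left
  le_card := by
    simpa [hd] using h.le_card
  disjoint := by
    intro S₁ h₁ S₂ h₂ hne
    rw [mem_insert] at h₁ h₂
    rcases h₁ with rfl | h₁ <;> rcases h₂ with rfl | h₂
    · exact absurd rfl hne
    · exact hSA.mono_right (h.subset _ h₂)
    · exact (hSA.mono_right (h.subset _ h₁)).symm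
    · exact h.disjoint _ h₁ _ h₂ hne

theorem IsSaturated.notMem {s d : ℕ} {T : Finset (Finset V)} {A B S : Finset V}
    (h : IsSaturated G s d T A B) (hs : 0 < s) (hS : #S = s) (hSA : Disjoint S A) : S ∉ T := by
  intro hST
  have : S = ∅ := disjoint_self_iff_empty _ |>.1 (hSA.mono_right (h.subset S hST))
  simp [this] at hS
  omega

end Deterministic

end UniformHypergraph

namespace UniformHypergraph

open Finset
open scoped FinsetFamily

/-! ### Depth-first search for a monochromatic tight path. -/

section Search

variable {V : Type*} [DecidableEq V] [Fintype V] {G : SimpleGraph V} [DecidableRel G.Adj]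

/-- A state of the depth-first search for a tight path in `F`: the current path `P` of length `l`,
the discarded sets `T`, and the set `A` of all discarded vertices. -/
structure IsSearchState (G : SimpleGraph V) [DecidableRel G.Adj] (s d m : ℕ)
    (F T : Finset (Finset V)) (A : Finset V) (P : ℕ → V) (l : ℕ) : Prop where
  path : IsTightPathIn s F P l
  le_length : s ≤ l
  disjoint : Disjoint ((range l).image P) A
  saturated : IsSaturated G s d T A (A ∪ (range l).image P)
  card_T : #T = m
  card_A : #A ≤ 2 * s * m

/-- A path of the search that is not yet of length `n` can be extended until its end has to be
discarded; afterwards either enough of the path is left, or the rest is discarded too. -/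
theorem IsSearchState.discard {s d m n l : ℕ} {F T : Finset (Finset V)} {A : Finset V} {P : ℕ → V}
    (hs : 0 < s) (hF : ∀ e ∈ F, e ∈ G.cliqueFinset (s + 1))
    (hdeg : ∀ S ∈ ∂ F, d ≤ #{e ∈ F | S ⊆ e}) (hn : ∀ P, ¬ IsTightPathIn s F P n)
    (h : IsSearchState G s d m F T A P l) (hl : l < n) :
    (∃ T' A', IsSaturated G s d T' A' A' ∧ #T' = m + 1 ∧ #A' ≤ 2 * s * (m + 1)) ∨
      ∃ T' A' P' l', IsSearchState G s d (m + 1) F T' A' P' l' ∧ l' < n := by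
  have hFcard : ∀ e ∈ F, #e = s + 1 := fun e he =>
    (SimpleGraph.mem_cliqueFinset_iff.1 (hF e he)).card_eq
  induction hk : n - l generalizing P l with
  | zero => omega
  | succ k ih =>
    have hsl := h.le_length
    set S := (Ico (l - s) l).image P with hSdef
    have hS' : S = (Ico (l - s) (l - s + s)).image P := by rw [Nat.sub_add_cancel hsl]
    have hScard : #S = s := by rw [hS']; exact h.path.card_window (by omega)
    have hSsub : S ⊆ (range l).image P := image_subset_image fun x hx => by
      simp only [mem_Ico] at hx
      simp only [mem_range]
      omega
    have hSA : Disjoint S A := h.disjoint.mono_left hSsub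
    by_cases hex : ∃ w, insert w S ∈ F ∧ w ∉ A ∪ (range l).image P
    · obtain ⟨w, hwF, hw⟩ := hex
      rw [mem_union, not_or] at hw
      have hpath := h.path.extend hFcard hs hsl hw.2 hwF
      rcases Nat.lt_or_ge (l + 1) n with hl' | hl'
      · have himg : (range (l + 1)).image (Function.update P l w) =
            insert w ((range l).image P) := by
          rw [range_add_one, image_insert, Function.update_self]
          congr 1
          refine image_congr fun x hx => Function.update_of_ne ?_ _ _
          simp only [coe_range, Set.mem_Iio] at hx
          omega
        refine ih (l := l + 1) ⟨hpath, by omega, ?_, ?_, h.card_T, h.card_A⟩ hl' (by omega)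
        · rw [himg, disjoint_insert_left]
          exact ⟨hw.1, h.disjoint⟩
        · refine h.saturated.mono Subset.rfl (union_subset_union_right ?_)
          rw [himg]
          exact subset_insert _ _
      · exact absurd (hpath.mono (by omega)) (hn _)
    · push Not at hex
      -- Every set of F through S is `insert w S` with w a common neighbour of S, and being stuck
      -- puts w in A or on the path.
      have hd : d ≤ #(commonNbrs G S ∩ (A ∪ (range l).image P)) := by
        have hSF : S ∈ ∂ F := by rw [hS']; exact h.path.shadow_mem _ (by omega)
        refine (hdeg S hSF).trans ((card_le_card ?_).trans
          (card_image_le (f := fun w => insert w S)))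
        intro e he
        obtain ⟨heF, hSe⟩ := mem_filter.1 he
        obtain ⟨w, hwS, rfl⟩ := exists_eq_insert_iff.2 ⟨hSe, by rw [hScard, hFcard e heF]⟩
        refine mem_image.2 ⟨w, mem_inter.2 ⟨mem_commonNbrs.2 fun v hv => ?_, hex w heF⟩, rfl⟩
        refine (SimpleGraph.mem_cliqueFinset_iff.1 (hF _ heF)).isClique ?_ ?_ ?_
        · simp [hv]
        · simp
        · rintro rfl
          exact hwS hv
      have hsat := h.saturated.insert hScard hSA hd
      have hcard : #(insert S T) = m + 1 := by
        rw [card_insert_of_notMem (h.saturated.notMem hs hScard hSA), h.card_T]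
      have hA := h.card_A
      -- A remainder of fewer than s vertices cannot continue the search and joins A too. Then l <
      -- 2s vertices go in one discard, hence the factor 2s in `card_A`.
      rcases Nat.lt_or_ge (l - s) s with hls | hls
      · refine Or.inl ⟨insert S T, A ∪ (range l).image P,
          hsat.mono (union_subset_union_right hSsub) Subset.rfl, hcard, ?_⟩
        have h1 := card_union_le A ((range l).image P)
        have h2 := card_image_le (s := range l) (f := P)
        rw [card_range] at h2
        rw [mul_add]
        omega
      · refine Or.inr ⟨insert S T, A ∪ S, P, l - s,
          ⟨h.path.mono (Nat.sub_le _ _), hls, ?_, ?_, hcard, ?_⟩, by omega⟩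
        · rw [disjoint_union_right]
          refine ⟨h.disjoint.mono_left (image_subset_image (range_mono (Nat.sub_le _ _))), ?_⟩
          rw [disjoint_left]
          intro x hx hxS
          obtain ⟨a, ha, rfl⟩ := mem_image.1 hx
          obtain ⟨b, hb, hab⟩ := mem_image.1 hxS
          simp only [mem_range] at ha
          simp only [mem_Ico] at hb
          have := h.path.injOn (by simpa using hb.2) (by simp; omega) hab
          omega
        -- Moving S from the path to A leaves their union unchanged.
        · refine hsat.mono Subset.rfl ?_
          rw [union_assoc, hSdef, ← image_union, range_eq_Ico, range_eq_Ico, union_comm (Ico _ _),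
            Ico_union_Ico_eq_Ico (Nat.zero_le _) (Nat.sub_le _ _)]
        · have h1 := card_union_le A S
          rw [mul_add]
          omega

/-- A graph in which all `s`-sets have many common neighbours, but in which there are no `t`
disjoint `s`-sets that have many common neighbours in a small set, contains in every colouring of
its `(s + 1)`-cliques a monochromatic tight path. -/
theorem exists_mono_tightPath {s d D n r t : ℕ} (hs : 0 < s) (hsn : s < n)
    (hD : ∀ S : Finset V, #S = s → D ≤ #(commonNbrs G S))
    (hdD : (s + 1) * (r * d) + d < D) (hV : 2 * s * t + s ≤ Fintype.card V)
    (hT : ∀ T B, #T = t → #B ≤ 2 * s * t + n → ¬ IsSaturated G s d T B B)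
    (c : Finset V → Fin r) :
    ∃ (i : Fin r) (F : Finset (Finset V)) (P : ℕ → V), IsTightPathIn s F P n ∧
      ∀ e ∈ F, e ∈ G.cliqueFinset (s + 1) ∧ c e = i := by
  by_contra hcon
  push Not at hcon
  -- The first alternative is the situation between two searches, with no path in progress; the next
  -- search may use another colour.
  have key : ∀ m ≤ t,
      (∃ T A, IsSaturated G s d T A A ∧ #T = m ∧ #A ≤ 2 * s * m) ∨
      ∃ (i : Fin r) (F T : Finset (Finset V)) (A : Finset V) (P : ℕ → V) (l : ℕ),
        (∀ e ∈ F, e ∈ G.cliqueFinset (s + 1) ∧ c e = i) ∧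
        (∀ S ∈ ∂ F, d ≤ #{e ∈ F | S ⊆ e}) ∧ IsSearchState G s d m F T A P l ∧ l < n := by
    intro m
    induction m with
    | zero =>
      exact fun _ => Or.inl ⟨∅, ∅, ⟨by simp, by simp, by simp, by simp⟩, by simp, by simp⟩
    | succ m ih =>
      intro hm
      have step : (∃ (i : Fin r) (F T : Finset (Finset V)) (A : Finset V) (P : ℕ → V) (l : ℕ),
          (∀ e ∈ F, e ∈ G.cliqueFinset (s + 1) ∧ c e = i) ∧
          (∀ S ∈ ∂ F, d ≤ #{e ∈ F | S ⊆ e}) ∧ IsSearchState G s d m F T A P l ∧ l < n) →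
          ((∃ T A, IsSaturated G s d T A A ∧ #T = m + 1 ∧ #A ≤ 2 * s * (m + 1)) ∨
          ∃ (i : Fin r) (F T : Finset (Finset V)) (A : Finset V) (P : ℕ → V) (l : ℕ),
          (∀ e ∈ F, e ∈ G.cliqueFinset (s + 1) ∧ c e = i) ∧
          (∀ S ∈ ∂ F, d ≤ #{e ∈ F | S ⊆ e}) ∧ IsSearchState G s d (m + 1) F T A P l ∧ l < n) := by
        rintro ⟨i, F, T, A, P, l, hF, hdeg, hst, hl⟩
        have hno : ∀ P, ¬ IsTightPathIn s F P n := fun P hP => by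
          obtain ⟨e, he, he'⟩ := hcon i F P hP
          exact he' (hF e he).1 (hF e he).2
        rcases hst.discard hs (fun e he => (hF e he).1) hdeg hno hl with h | ⟨T', A', P', l', h⟩
        · exact Or.inl h
        · exact Or.inr ⟨i, F, T', A', P', l', hF, hdeg, h⟩
      rcases ih (by omega) with ⟨T, A, hsat, hTm, hAm⟩ | h
      · by_cases hbad : ∃ S : Finset V, #S = s ∧ Disjoint S A ∧ d ≤ #(commonNbrs G S ∩ A)
        · obtain ⟨S, hS, hSA, hSd⟩ := hbad
          refine Or.inl ⟨insert S T, A ∪ S,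
            (hsat.insert hS hSA hSd).mono Subset.rfl subset_union_left, ?_, ?_⟩
          · rw [card_insert_of_notMem (hsat.notMem hs hS hSA), hTm]
          · have := card_union_le A S
            rw [mul_add]
            omega
        · push Not at hbad
          have hmt : 2 * s * m ≤ 2 * s * t := Nat.mul_le_mul_left _ (by omega)
          obtain ⟨i, F, hne, hF, hdeg⟩ := exists_mono_family (G := G) (W := Aᶜ) (s := s)
            (m := D - d) (d := d) (by omega) (by rw [card_compl]; omega) (fun S hSA hS => by
              have h1 := hbad S hS (disjoint_left.2 fun x hx => mem_compl.1 (hSA hx))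
              have h2 := hD S hS
              have h3 : #(commonNbrs G S) = #(commonNbrs G S ∩ A) + #(commonNbrs G S ∩ Aᶜ) := by
                rw [← sdiff_eq_inter_compl, card_inter_add_card_sdiff]
              omega) c
          obtain ⟨P, hP⟩ := exists_isTightPathIn (s := s)
            (fun e he => (SimpleGraph.mem_cliqueFinset_iff.1 (hF e he).1).card_eq) hne
          refine step ⟨i, F, T, A, P, s, fun e he => ⟨(hF e he).1, (hF e he).2.2⟩, hdeg,
            ⟨hP, le_rfl, ?_, hsat.mono Subset.rfl subset_union_left, hTm, hAm⟩, hsn⟩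
          have hsh := hP.shadow_mem 0 (by omega)
          rw [zero_add, ← range_eq_Ico] at hsh
          obtain ⟨e, he, hsub, -⟩ := mem_shadow_iff_exists_mem_card_add_one.1 hsh
          exact disjoint_left.2 fun x hx => mem_compl.1 ((hF e he).2.1 (hsub hx))
      · exact step h
  rcases key t le_rfl with ⟨T, A, hsat, hTt, hA⟩ | ⟨i, F, T, A, P, l, -, -, h, hl⟩
  · exact hT T A hTt (by omega) hsat
  · refine hT T (A ∪ (range l).image P) h.card_T ?_ (h.saturated.mono subset_union_left Subset.rfl)
    have h1 := card_union_le A ((range l).image P)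
    have h2 := card_image_le (s := range l) (f := P)
    have h3 := h.card_A
    rw [card_range] at h2
    omega

/-- The hypergraph of the `k`-cliques of a graph. -/
def cliqueHypergraph (G : SimpleGraph V) [DecidableRel G.Adj] (k : ℕ) : UniformHypergraph k V where
  edges := G.cliqueFinset k
  uniform _ he := (SimpleGraph.mem_cliqueFinset_iff.1 he).card_eq

theorem cliqueHypergraph_arrows_tightPath {s d D n r t : ℕ} (hs : 0 < s) (hsn : s < n)
    (hr : 0 < r) (hD : ∀ S : Finset V, #S = s → D ≤ #(commonNbrs G S))
    (hdD : (s + 1) * (r * d) + d < D) (hV : 2 * s * t + s ≤ Fintype.card V)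
    (hT : ∀ T B, #T = t → #B ≤ 2 * s * t + n → ¬ IsSaturated G s d T B B) :
    (cliqueHypergraph G (s + 1)).Arrows (tightPath (s + 1) n) r := by
  intro c
  obtain ⟨i, F, P, hP, hF⟩ := exists_mono_tightPath hs hsn hD hdD hV hT
    -- Colour 0 on non-edges is a filler: F consists of cliques, so it is never read.
    (fun e => if he : e ∈ (cliqueHypergraph G (s + 1)).edges then c ⟨e, he⟩ else ⟨0, hr⟩)
  refine ⟨i, ⟨fun j : Fin n => P j, fun a b hab => Fin.ext
    (hP.injOn (by simp) (by simp) hab)⟩, ?_⟩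
  intro e he
  simp only [tightPath, mem_image, mem_range] at he
  obtain ⟨j, hj, rfl⟩ := he
  have himg : (Finset.map ⟨fun j : Fin n => P j, fun a b hab => Fin.ext
      (hP.injOn (by simp) (by simp) hab)⟩
      {x : Fin n | j ≤ (x : ℕ) ∧ (x : ℕ) < j + (s + 1)}) = (Ico j (j + (s + 1))).image P := by
    ext v
    simp only [mem_map, mem_filter, mem_univ, true_and, mem_image,
      mem_Ico]
    constructor
    · rintro ⟨a, ha, rfl⟩
      exact ⟨a, ha, rfl⟩
    · rintro ⟨a, ha, rfl⟩
      exact ⟨⟨a, by omega⟩, ha, rfl⟩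
  have hmem := hF _ (hP.window_mem j (by omega))
  rw [← himg] at hmem
  have hmem1 : _ ∈ (cliqueHypergraph G (s + 1)).edges := hmem.1
  refine ⟨hmem1, ?_⟩
  have := hmem.2
  rwa [dif_pos hmem1] at this

end Search

end UniformHypergraph

namespace UniformHypergraph

open Finset
open scoped BigOperators

/-! ### Exponential moments for disjoint blocks. -/

section RandomFunction

variable {E ι : Type*} [Fintype E] [DecidableEq E] {q : ℕ} [NeZero q]

theorem expect_forall_eq_zero (M : Finset E) :
    𝔼 f : E → Fin q, (if ∀ e ∈ M, f e = 0 then 1 else 0 : ℝ) = ((q : ℝ)⁻¹) ^ #M := by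
  have hq : (q : ℝ) ≠ 0 := NeZero.ne _
  have hset : ({f : E → Fin q | ∀ e ∈ M, f e = 0} : Finset _) =
      Fintype.piFinset fun e => if e ∈ M then {0} else univ := by
    ext f
    simp only [mem_filter, mem_univ, true_and, Fintype.mem_piFinset]
    refine forall_congr' fun e => ?_
    by_cases he : e ∈ M <;> simp [he]
  have hcard : #{f : E → Fin q | ∀ e ∈ M, f e = 0} = q ^ #Mᶜ := by
    rw [hset, Fintype.card_piFinset]
    have : ∀ e, #(if e ∈ M then ({0} : Finset (Fin q)) else univ) = if e ∈ M then 1 else q := by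
      intro e
      by_cases he : e ∈ M <;> simp [he]
    simp_rw [this]
    rw [prod_ite, prod_const_one, one_mul, prod_const]
    congr 2
    ext e
    simp
  rw [Fintype.expect_eq_sum_div_card, sum_boole, hcard, Fintype.card_fun, Fintype.card_fin,
    ← card_add_card_compl M]
  push_cast
  rw [pow_add, inv_pow]
  field_simp

/-- The generating function of the number of blocks `b i` on which a random function vanishes. -/
theorem expect_pow_card_filter {s : ℕ} {Q : Finset ι} {b : ι → Finset E}
    (hcard : ∀ i ∈ Q, #(b i) = s) (hdisj : (Q : Set ι).PairwiseDisjoint b) (z : ℝ) :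
    𝔼 f : E → Fin q, z ^ #{i ∈ Q | ∀ e ∈ b i, f e = 0} =
      (1 + (z - 1) * ((q : ℝ)⁻¹) ^ s) ^ #Q := by
  classical
  -- The power is a product of factors 1 + (z - 1)·indicator. After expansion, disjointness of the
  -- blocks turns each mean into a power of 1/q.
  have hexp : ∀ f : E → Fin q, z ^ #{i ∈ Q | ∀ e ∈ b i, f e = 0} =
      ∑ M ∈ Q.powerset, (z - 1) ^ #M * (if ∀ e ∈ M.biUnion b, f e = 0 then 1 else 0) := by
    intro f
    have h1 : z ^ #{i ∈ Q | ∀ e ∈ b i, f e = 0} =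
        ∏ i ∈ Q, (1 + (z - 1) * (if ∀ e ∈ b i, f e = 0 then 1 else 0)) := by
      rw [← prod_const, prod_filter]
      refine prod_congr rfl fun i _ => ?_
      split_ifs <;> ring
    rw [h1, prod_one_add]
    refine sum_congr rfl fun M _ => ?_
    rw [prod_mul_distrib, prod_const, prod_boole]
    congr 2
    simp only [mem_biUnion, eq_iff_iff]
    constructor
    · rintro h e ⟨i, hi, he⟩
      exact h i hi e he
    · exact fun h i hi e he => h e ⟨i, hi, he⟩
  simp_rw [hexp]
  rw [expect_sum_comm]
  have h2 : ∀ M ∈ Q.powerset, 𝔼 f : E → Fin q, (z - 1) ^ #M *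
      (if ∀ e ∈ M.biUnion b, f e = 0 then 1 else 0 : ℝ) =
      ∏ _i ∈ M, ((z - 1) * ((q : ℝ)⁻¹) ^ s) := by
    intro M hM
    have hMQ := mem_powerset.1 hM
    rw [← mul_expect, expect_forall_eq_zero,
      card_biUnion (hdisj.subset (by exact_mod_cast hMQ)),
      sum_congr rfl fun i hi => hcard i (hMQ hi)]
    rw [sum_const, prod_const, smul_eq_mul, mul_pow, ← pow_mul, mul_comm s]
  rw [sum_congr rfl h2, ← prod_one_add, prod_const]

/-- The case z = e, with e - 1 ≤ 2 and 1 + x ≤ exp x. -/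
theorem expect_exp_card_filter_le {s : ℕ} {Q : Finset ι} {b : ι → Finset E}
    (hcard : ∀ i ∈ Q, #(b i) = s) (hdisj : (Q : Set ι).PairwiseDisjoint b) :
    𝔼 f : E → Fin q, Real.exp (#{i ∈ Q | ∀ e ∈ b i, f e = 0}) ≤
      Real.exp (2 * ((q : ℝ)⁻¹) ^ s * #Q) := by
  have h := expect_pow_card_filter (q := q) hcard hdisj (Real.exp 1)
  simp_rw [← Real.exp_nat_mul, mul_one] at h
  have hp : 0 ≤ ((q : ℝ)⁻¹) ^ s := by positivity
  have he := Real.exp_one_lt_d9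
  have he' := Real.add_one_le_exp (1 : ℝ)
  rw [h, mul_comm _ (#Q : ℝ), Real.exp_nat_mul]
  refine pow_le_pow_left₀ (by nlinarith) ?_ _
  refine le_trans ?_ (Real.add_one_le_exp _)
  nlinarith

/-- The case z = 1/e, with 1 - 1/e ≥ 1/2. -/
theorem expect_exp_neg_card_filter_le {s : ℕ} {Q : Finset ι} {b : ι → Finset E}
    (hcard : ∀ i ∈ Q, #(b i) = s) (hdisj : (Q : Set ι).PairwiseDisjoint b) :
    𝔼 f : E → Fin q, Real.exp (-(#{i ∈ Q | ∀ e ∈ b i, f e = 0} : ℝ)) ≤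
      Real.exp (-(((q : ℝ)⁻¹) ^ s * #Q / 2)) := by
  have h := expect_pow_card_filter (q := q) hcard hdisj (Real.exp (-1))
  simp_rw [← Real.exp_nat_mul, mul_neg, mul_one] at h
  have hp : 0 ≤ ((q : ℝ)⁻¹) ^ s := by positivity
  have hp1 : ((q : ℝ)⁻¹) ^ s ≤ 1 := pow_le_one₀ (by positivity)
    (inv_le_one_of_one_le₀ (by exact_mod_cast NeZero.one_le))
  have he := Real.exp_neg_one_lt_d9
  have he' := Real.exp_pos (-1)
  rw [h, show -(((q : ℝ)⁻¹) ^ s * #Q / 2) = #Q * (-(((q : ℝ)⁻¹) ^ s / 2)) by ring,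
    Real.exp_nat_mul]
  refine pow_le_pow_left₀ (by nlinarith) ?_ _
  refine le_trans ?_ (Real.add_one_le_exp _)
  nlinarith

end RandomFunction

/-! ### The random graph and its stars. -/

section RandomGraph

/-- An arbitrary ranking of the sets of vertices. -/
noncomputable def rank {α : Type*} [Fintype α] (S : Finset α) : ℕ :=
  Fintype.equivFin (Finset α) S

theorem rank_injective {α : Type*} [Fintype α] : Function.Injective (rank : Finset α → ℕ) :=
  Fin.val_injective.comp (Equiv.injective _)

variable {V : Type*} [DecidableEq V]

/-- The pairs that join a vertex to a set. -/
def star (x : Finset V × V) : Finset (Sym2 V) := x.1.image fun v => s(v, x.2)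

theorem card_star (x : Finset V × V) : #(star x) = #x.1 := by
  refine card_image_of_injective _ fun v v' h => ?_
  exact Sym2.congr_left.1 h

variable [Fintype V] {q : ℕ} [NeZero q]

/-- The graph whose edges are the pairs on which `f` vanishes. -/
def zeroGraph (f : Sym2 V → Fin q) : SimpleGraph V where
  Adj u v := u ≠ v ∧ f s(u, v) = 0
  symm := ⟨fun u v h => ⟨h.1.symm, by rw [Sym2.eq_swap]; exact h.2⟩⟩
  loopless := ⟨fun _ h => h.1 rfl⟩

instance (f : Sym2 V → Fin q) : DecidableRel (zeroGraph f).Adj :=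
  fun u v => inferInstanceAs (Decidable (u ≠ v ∧ f s(u, v) = 0))

theorem mem_commonNbrs_zeroGraph {f : Sym2 V → Fin q} {S : Finset V} {w : V} :
    w ∈ commonNbrs (zeroGraph f) S ↔ w ∉ S ∧ ∀ e ∈ star (S, w), f e = 0 := by
  rw [mem_commonNbrs]
  simp only [zeroGraph, star, mem_image, forall_exists_index, and_imp, forall_apply_eq_imp_iff₂]
  constructor
  · exact fun h => ⟨fun hw => (h w hw).1 rfl, fun v hv => (h v hv).2⟩
  · rintro ⟨h1, h2⟩ v hv
    exact ⟨fun h => h1 (h ▸ hv), h2 v hv⟩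

theorem expect_exp_neg_card_commonNbrs_le (S : Finset V) :
    𝔼 f : Sym2 V → Fin q, Real.exp (-(#(commonNbrs (zeroGraph f) S) : ℝ)) ≤
      Real.exp (-(((q : ℝ)⁻¹) ^ #S * ((Fintype.card V - #S : ℕ) : ℝ) / 2)) := by
  have h := expect_exp_neg_card_filter_le (q := q) (s := #S) (Q := Sᶜ)
    (b := fun w => star (S, w)) (fun w _ => card_star _) (by
      intro w hw w' hw' hne
      refine disjoint_left.2 fun e he he' => ?_
      obtain ⟨v, hv, rfl⟩ := mem_image.1 he
      obtain ⟨v', hv', h⟩ := mem_image.1 he'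
      simp only [coe_compl, Set.mem_compl_iff, mem_coe] at hw hw' hv hv' h
      rcases Sym2.eq_iff.1 h with ⟨-, h⟩ | ⟨h, -⟩
      · exact hne h.symm
      · exact hw (h ▸ hv'))
  rw [card_compl] at h
  convert h using 6
  ext w
  simp [mem_commonNbrs_zeroGraph]

theorem expect_card_cliqueFinset (k : ℕ) :
    𝔼 f : Sym2 V → Fin q, (#((zeroGraph f).cliqueFinset k) : ℝ) =
      (Fintype.card V).choose k * ((q : ℝ)⁻¹) ^ (k.choose 2) := by
  have h : ∀ f : Sym2 V → Fin q, (#((zeroGraph f).cliqueFinset k) : ℝ) =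
      ∑ e ∈ (univ : Finset V).powersetCard k,
        if ∀ x ∈ e.offDiag.image (Function.uncurry Sym2.mk), f x = 0 then 1 else 0 := by
    intro f
    rw [sum_boole]
    congr 2
    ext e
    simp only [SimpleGraph.mem_cliqueFinset_iff, SimpleGraph.isNClique_iff, mem_filter,
      mem_powersetCard, subset_univ, true_and]
    rw [and_comm]
    refine and_congr_right fun _ => ?_
    simp only [mem_image, mem_offDiag, Prod.exists, Function.uncurry_apply_pair,
      SimpleGraph.isClique_iff, Set.Pairwise, mem_coe, zeroGraph]
    constructor
    · rintro h x ⟨a, b, ⟨ha, hb, hab⟩, rfl⟩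
      exact (h ha hb hab).2
    · exact fun h a ha b hb hab => ⟨hab, h _ ⟨a, b, ⟨ha, hb, hab⟩, rfl⟩⟩
  simp_rw [h]
  rw [expect_sum_comm, sum_congr rfl (g := fun _ => ((q : ℝ)⁻¹) ^ (k.choose 2))]
  · simp
  · intro e he
    rw [expect_forall_eq_zero, Sym2.card_image_offDiag, (mem_powersetCard.1 he).2]

/-- The pairs `(S, w)` in `T × B` such that no set of `T` that contains `w` is ranked at or
above `S`. -/
noncomputable def lowPairs (T : Finset (Finset V)) (B : Finset V) : Finset (Finset V × V) :=
  {x ∈ T ×ˢ B | ∀ S ∈ T, x.2 ∈ S → rank S < rank x.1}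

/-- The pairs `(S, w)` in `T × B` such that a set of `T` that contains `w` is ranked above `S`. -/
noncomputable def highPairs (T : Finset (Finset V)) (B : Finset V) : Finset (Finset V × V) :=
  {x ∈ T ×ˢ B | ∃ S ∈ T, x.2 ∈ S ∧ rank x.1 < rank S}

/-- As the sets of T are disjoint, distinct stars can only meet crosswise, with w ∈ S' and w' ∈ S.
Each of S, S' would then be ranked below the other. -/
theorem pairwiseDisjoint_star_lowPairs {T : Finset (Finset V)}
    (hT : ∀ S ∈ T, ∀ S' ∈ T, S ≠ S' → Disjoint S S') (B : Finset V) :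
    (lowPairs T B : Set (Finset V × V)).PairwiseDisjoint star := by
  rintro ⟨S, w⟩ hx ⟨S', w'⟩ hx' hne
  simp only [lowPairs, coe_filter, mem_product, Set.mem_ofPred_eq] at hx hx'
  refine disjoint_left.2 fun e he he' => ?_
  obtain ⟨v, hv, rfl⟩ := mem_image.1 he
  obtain ⟨v', hv', h⟩ := mem_image.1 he'
  simp only at hv hv' h
  rcases Sym2.eq_iff.1 h with ⟨h1, h2⟩ | ⟨h1, h2⟩
  · refine hne (Prod.ext ?_ h2.symm)
    by_contra hSS
    exact disjoint_left.1 (hT S hx.1.1 S' hx'.1.1 hSS) hv (h1 ▸ hv')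
  · have a1 := hx.2 S' hx'.1.1 (h1 ▸ hv')
    have a2 := hx'.2 S hx.1.1 (h2 ▸ hv)
    exact a1.asymm a2

/-- The crosswise case again: S' is the only set of T containing w, and S the only one containing
w', so each would be ranked above the other. -/
theorem pairwiseDisjoint_star_highPairs {T : Finset (Finset V)}
    (hT : ∀ S ∈ T, ∀ S' ∈ T, S ≠ S' → Disjoint S S') (B : Finset V) :
    (highPairs T B : Set (Finset V × V)).PairwiseDisjoint star := by
  rintro ⟨S, w⟩ hx ⟨S', w'⟩ hx' hne
  simp only [highPairs, coe_filter, mem_product, Set.mem_ofPred_eq] at hx hx'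
  have huniq : ∀ S ∈ T, ∀ S' ∈ T, ∀ x, x ∈ S → x ∈ S' → S = S' := fun S h S' h' x hx hx' => by
    by_contra hSS
    exact disjoint_left.1 (hT S h S' h' hSS) hx hx'
  refine disjoint_left.2 fun e he he' => ?_
  obtain ⟨v, hv, rfl⟩ := mem_image.1 he
  obtain ⟨v', hv', h⟩ := mem_image.1 he'
  simp only at hv hv' h
  rcases Sym2.eq_iff.1 h with ⟨h1, h2⟩ | ⟨h1, h2⟩
  · exact hne (Prod.ext (huniq S hx.1.1 S' hx'.1.1 v hv (h1 ▸ hv')) h2.symm)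
  · obtain ⟨R, hR, hwR, hlt⟩ := hx.2
    obtain ⟨R', hR', hwR', hlt'⟩ := hx'.2
    obtain rfl := huniq R hR S' hx'.1.1 w hwR (h1 ▸ hv')
    obtain rfl := huniq R' hR' S hx.1.1 w' hwR' (h2 ▸ hv)
    omega

/-- The number of pairs of `Q` whose star is contained in the graph given by `f`. -/
def starCount (Q : Finset (Finset V × V)) (f : Sym2 V → Fin q) : ℕ :=
  #{x ∈ Q | ∀ e ∈ star x, f e = 0}

/-- A pair of `T ×ˢ B` missing from both families has w ∈ S, which is impossible for a common
neighbour. -/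
theorem IsSaturated.le_starCount {s d : ℕ} {T : Finset (Finset V)} {A B : Finset V}
    {f : Sym2 V → Fin q} (h : IsSaturated (zeroGraph f) s d T A B) :
    #T * d ≤ starCount (lowPairs T B) f + starCount (highPairs T B) f := by
  calc #T * d ≤ ∑ S ∈ T, #(commonNbrs (zeroGraph f) S ∩ B) := by
        rw [← smul_eq_mul]
        exact card_nsmul_le_sum _ _ _ h.le_card
    _ = #(T.sigma fun S => commonNbrs (zeroGraph f) S ∩ B) := (card_sigma _ _).symm
    _ ≤ #({x ∈ lowPairs T B | ∀ e ∈ star x, f e = 0} ∪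
        {x ∈ highPairs T B | ∀ e ∈ star x, f e = 0}) := by
        refine card_le_card_of_injOn (fun x => (x.1, x.2)) ?_ ?_
        · rintro ⟨S, w⟩ hx
          simp only [coe_sigma, Set.mem_sigma_iff, mem_coe, mem_inter,
            mem_commonNbrs_zeroGraph] at hx
          obtain ⟨hS, ⟨hwS, hf⟩, hwB⟩ := hx
          simp only [mem_coe, mem_union, mem_filter, lowPairs, highPairs, mem_product, hS, hwB,
            true_and]
          by_cases hlow : ∀ S' ∈ T, w ∈ S' → rank S' < rank S
          · exact Or.inl ⟨hlow, hf⟩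
          · push Not at hlow
            obtain ⟨S', hS', hwS', hle⟩ := hlow
            refine Or.inr ⟨⟨S', hS', hwS', hle.lt_of_ne fun heq => ?_⟩, hf⟩
            exact hwS (rank_injective heq ▸ hwS')
        · rintro ⟨S, w⟩ _ ⟨S', w'⟩ _ h
          simp only [Prod.mk.injEq] at h
          rw [h.1, h.2]
    _ ≤ _ := card_union_le _ _

theorem expect_exp_starCount_le {s t b : ℕ} {T : Finset (Finset V)} {B : Finset V}
    {Q : Finset (Finset V × V)} (hT : ∀ S ∈ T, #S = s) (hTt : #T = t) (hB : #B ≤ b)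
    (hQ : Q ⊆ T ×ˢ B) (hdisj : (Q : Set (Finset V × V)).PairwiseDisjoint star) :
    𝔼 f : Sym2 V → Fin q, Real.exp (starCount Q f) ≤
      Real.exp (2 * ((q : ℝ)⁻¹) ^ s * (t * b)) := by
  refine (expect_exp_card_filter_le (q := q) (s := s) (fun x hx => ?_) hdisj).trans ?_
  · rw [card_star, hT _ (mem_product.1 (hQ hx)).1]
  · refine Real.exp_le_exp.2 (mul_le_mul_of_nonneg_left ?_ (by positivity))
    have := card_le_card hQ
    rw [card_product, hTt] at this
    exact_mod_cast this.trans (Nat.mul_le_mul_left _ hB)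

end RandomGraph

end UniformHypergraph

namespace UniformHypergraph

open Finset
open scoped BigOperators

/-! ### The first-moment argument. -/

section Existence

variable {V : Type*} [Fintype V] [DecidableEq V]

/-- A first-moment argument for the three properties of a random graph that are needed. -/
theorem exists_zeroGraph {s t b d D k q : ℕ} [NeZero q] {K : ℝ} (hK : 0 < K)
    (hKc : ((Fintype.card V).choose k : ℝ) * ((q : ℝ)⁻¹) ^ (k.choose 2) ≤ K)
    (hlow : (Fintype.card V : ℝ) ^ s * (Real.exp D *
      Real.exp (-(((q : ℝ)⁻¹) ^ s * ((Fintype.card V - s : ℕ) : ℝ) / 2))) < 1 / 4)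
    (hupp : ((Fintype.card V : ℝ) ^ s) ^ t * 2 ^ (Fintype.card V) *
      (2 * (Real.exp (-(t * d / 2)) * Real.exp (2 * ((q : ℝ)⁻¹) ^ s * (t * b)))) < 1 / 4) :
    ∃ f : Sym2 V → Fin q, (∀ S : Finset V, #S = s → D ≤ #(commonNbrs (zeroGraph f) S)) ∧
      (∀ T B, #T = t → #B ≤ b → ¬ IsSaturated (zeroGraph f) s d T B B) ∧
      (#((zeroGraph f).cliqueFinset k) : ℝ) ≤ 2 * K := by
  classical
  set N := Fintype.card V with hN
  set 𝒮 : Finset (Finset V) := univ.powersetCard s with h𝒮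
  set I : Finset (Finset (Finset V) × Finset V) :=
    {x ∈ (𝒮.powersetCard t) ×ˢ univ | #x.2 ≤ b ∧
      ∀ S ∈ x.1, ∀ S' ∈ x.1, S ≠ S' → Disjoint S S'} with hI
  have h𝒮card : (#𝒮 : ℝ) ≤ (N : ℝ) ^ s := by
    rw [h𝒮, card_powersetCard, card_univ]
    exact_mod_cast Nat.choose_le_pow _ _
  have hIcard : (#I : ℝ) ≤ ((N : ℝ) ^ s) ^ t * 2 ^ N := by
    have h1 : #I ≤ #𝒮 ^ t * 2 ^ N := by
      refine (card_filter_le _ _).trans ?_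
      rw [card_product, card_powersetCard, card_univ, Fintype.card_finset]
      exact Nat.mul_le_mul_right _ (Nat.choose_le_pow _ _)
    calc (#I : ℝ) ≤ (#𝒮 : ℝ) ^ t * 2 ^ N := by exact_mod_cast h1
      _ ≤ _ := by gcongr
  -- Markov's inequality in weighted form: a failure of the corresponding property makes φ₁ or φ₂ at
  -- least 1, or φ₃ greater than 1, while the three means add up to less than 1.
  set φ₁ : (Sym2 V → Fin q) → ℝ := fun f =>
    ∑ S ∈ 𝒮, Real.exp D * Real.exp (-(#(commonNbrs (zeroGraph f) S) : ℝ)) with hφ₁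
  set ψ : (Sym2 V → Fin q) → Finset (Finset V) × Finset V → ℝ := fun f x =>
    Real.exp (-(t * d / 2)) * (Real.exp (starCount (lowPairs x.1 x.2) f) +
      Real.exp (starCount (highPairs x.1 x.2) f)) with hψdef
  have hψ : ∀ f x, 0 ≤ ψ f x := fun f x => by positivity
  set φ₂ : (Sym2 V → Fin q) → ℝ := fun f =>
    ∑ x ∈ I, ψ f x with hφ₂
  set φ₃ : (Sym2 V → Fin q) → ℝ := fun f =>
    (2 * K)⁻¹ * (#((zeroGraph f).cliqueFinset k) : ℝ) with hφ₃
  have e1 : 𝔼 f, φ₁ f < 1 / 4 := by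
    refine lt_of_le_of_lt ?_ hlow
    rw [hφ₁, expect_sum_comm]
    refine (sum_le_card_nsmul _ _
      (Real.exp D * Real.exp (-(((q : ℝ)⁻¹) ^ s * ((N - s : ℕ) : ℝ) / 2)))
      fun S hS => ?_).trans ?_
    · rw [← mul_expect]
      have h := expect_exp_neg_card_commonNbrs_le (q := q) S
      rw [(mem_powersetCard.1 hS).2] at h
      exact mul_le_mul_of_nonneg_left h (Real.exp_pos _).le
    · rw [nsmul_eq_mul]
      exact mul_le_mul_of_nonneg_right h𝒮card (by positivity)
  have e2 : 𝔼 f, φ₂ f < 1 / 4 := by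
    refine lt_of_le_of_lt ?_ hupp
    rw [hφ₂, expect_sum_comm]
    refine (sum_le_card_nsmul _ _
      (2 * (Real.exp (-(t * d / 2)) * Real.exp (2 * ((q : ℝ)⁻¹) ^ s * (t * b))))
      fun x hx => ?_).trans ?_
    · rw [← mul_expect, expect_add_distrib]
      obtain ⟨hx1, hxb, hxd⟩ := mem_filter.1 hx
      obtain ⟨hxs, hxt⟩ := mem_powersetCard.1 (mem_product.1 hx1).1
      have hcard : ∀ S ∈ x.1, #S = s := fun S hS => (mem_powersetCard.1 (hxs hS)).2
      have a1 := expect_exp_starCount_le (q := q) (Q := lowPairs x.1 x.2) hcard hxt hxb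
        (filter_subset _ _) (pairwiseDisjoint_star_lowPairs hxd _)
      have a2 := expect_exp_starCount_le (q := q) (Q := highPairs x.1 x.2) hcard hxt hxb
        (filter_subset _ _) (pairwiseDisjoint_star_highPairs hxd _)
      calc _ ≤ Real.exp (-(t * d / 2)) * (Real.exp (2 * ((q : ℝ)⁻¹) ^ s * (t * b)) +
            Real.exp (2 * ((q : ℝ)⁻¹) ^ s * (t * b))) :=
            mul_le_mul_of_nonneg_left (add_le_add a1 a2) (Real.exp_pos _).le
        _ = _ := by ring
    · rw [nsmul_eq_mul]
      exact mul_le_mul_of_nonneg_right hIcard (by positivity)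
  have e3 : 𝔼 f, φ₃ f ≤ 1 / 2 := by
    rw [hφ₃, ← mul_expect, expect_card_cliqueFinset, mul_inv, mul_assoc]
    have : K⁻¹ * ((N.choose k : ℝ) * ((q : ℝ)⁻¹) ^ (k.choose 2)) ≤ 1 := by
      rw [inv_mul_le_iff₀ hK]
      simpa using hKc
    linarith
  obtain ⟨f, -, hf⟩ := exists_lt_of_expect_lt (s := univ) (f := fun f => φ₁ f + φ₂ f + φ₃ f)
    (a := 1) univ_nonempty (by rw [expect_add_distrib, expect_add_distrib]; linarith)
  have p1 : 0 ≤ φ₁ f := sum_nonneg fun S _ => by positivity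
  have p2 : 0 ≤ φ₂ f := sum_nonneg fun x _ => hψ f x
  have p3 : 0 ≤ φ₃ f := by simp only [hφ₃]; positivity
  refine ⟨f, fun S hS => ?_, fun T B hT hB hsat => ?_, ?_⟩
  · by_contra hlt
    have h1 : Real.exp D * Real.exp (-(#(commonNbrs (zeroGraph f) S) : ℝ)) ≤ φ₁ f :=
      single_le_sum (f := fun S => Real.exp D * Real.exp (-(#(commonNbrs (zeroGraph f) S) : ℝ)))
        (fun S _ => by positivity) (mem_powersetCard.2 ⟨subset_univ S, hS⟩)
    have h2 : (#(commonNbrs (zeroGraph f) S) : ℝ) ≤ D := by exact_mod_cast (not_le.1 hlt).le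
    rw [← Real.exp_add] at h1
    have h3 := Real.one_le_exp (show 0 ≤ (D : ℝ) + -(#(commonNbrs (zeroGraph f) S) : ℝ) by linarith)
    linarith
  · have hx : (T, B) ∈ I := by
      simp only [hI, h𝒮, mem_filter, mem_product, mem_powersetCard, mem_univ, and_true]
      exact ⟨⟨fun S hS => mem_powersetCard.2 ⟨subset_univ _, hsat.card_eq S hS⟩, hT⟩, hB,
        hsat.disjoint⟩
    have h1 : ψ f (T, B) ≤ φ₂ f := single_le_sum (f := ψ f) (fun x _ => hψ f x) hx
    simp only [hψdef] at h1
    have h2 := hsat.le_starCount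
    rw [hT] at h2
    have h2 : (t : ℝ) * d ≤ starCount (lowPairs T B) f + starCount (highPairs T B) f := by
      exact_mod_cast h2
    rw [mul_add, ← Real.exp_add, ← Real.exp_add] at h1
    have g1 := Real.exp_pos (-((t : ℝ) * d / 2) + starCount (lowPairs T B) f)
    have g2 := Real.exp_pos (-((t : ℝ) * d / 2) + starCount (highPairs T B) f)
    -- One of the two star counts is at least half of t·d, hence the halved exponent in ψ.
    rcases le_total ((t : ℝ) * d / 2) (starCount (lowPairs T B) f) with h | h
    · have := Real.one_le_exp
        (show 0 ≤ -((t : ℝ) * d / 2) + starCount (lowPairs T B) f by linarith)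
      linarith
    · have := Real.one_le_exp
        (show 0 ≤ -((t : ℝ) * d / 2) + starCount (highPairs T B) f by linarith)
      linarith
  · have h3 : (2 * K)⁻¹ * (#((zeroGraph f).cliqueFinset k) : ℝ) ≤ 1 := by
      change φ₃ f ≤ 1
      linarith
    rwa [inv_mul_le_iff₀ (by positivity), mul_one] at h3

end Existence

end UniformHypergraph

/-! ### Choice of parameters and numerical estimates. -/

namespace UniformHypergraph

open Finset

/-- A natural number whose `s`-th power is within a factor `2 ^ s` below `x`. -/
theorem exists_nat_pow_le {s : ℕ} (hs : 0 < s) {x : ℝ} (hx : 1 ≤ x) :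
    ∃ q : ℕ, 1 ≤ q ∧ (q : ℝ) ^ s ≤ x ∧ x ≤ 2 ^ s * (q : ℝ) ^ s := by
  have hx0 : 0 ≤ x := by linarith
  have hroot : (x ^ ((s : ℝ)⁻¹)) ^ s = x := Real.rpow_inv_natCast_pow hx0 hs.ne'
  have h1 : 1 ≤ x ^ ((s : ℝ)⁻¹) := Real.one_le_rpow hx (by positivity)
  have hq : 1 ≤ ⌊x ^ ((s : ℝ)⁻¹)⌋₊ := Nat.one_le_floor_iff _ |>.2 h1
  refine ⟨⌊x ^ ((s : ℝ)⁻¹)⌋₊, hq, ?_, ?_⟩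
  · calc _ ≤ (x ^ ((s : ℝ)⁻¹)) ^ s :=
          pow_le_pow_left₀ (by positivity) (Nat.floor_le (by positivity)) _
      _ = x := hroot
  · rw [← mul_pow]
    calc x = (x ^ ((s : ℝ)⁻¹)) ^ s := hroot.symm
      _ ≤ _ := by
        refine pow_le_pow_left₀ (by positivity) ?_ _
        have h2 := Nat.lt_floor_add_one (x ^ ((s : ℝ)⁻¹))
        have h3 : (1 : ℝ) ≤ (⌊x ^ ((s : ℝ)⁻¹)⌋₊ : ℝ) := by exact_mod_cast hq
        linarith

theorem exp_neg_two_lt : Real.exp (-2) < 1 / 4 := by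
  have h := Real.exp_neg_one_lt_d9
  have h0 := Real.exp_pos (-1)
  rw [show (-2 : ℝ) = -1 + -1 by norm_num, Real.exp_add]
  nlinarith

/-- Union bound over s-sets. Since N - s ≥ N/2, the exponent gains pN/4; D takes at most half of
this, and the remaining pN/8 pays for N^s. -/
theorem pow_mul_exp_lt {N s D : ℕ} {p L : ℝ} (hp : 0 ≤ p) (hN : 2 * (s : ℝ) ≤ N)
    (hD : (D : ℝ) ≤ p * N / 8) (hNs : (N : ℝ) ^ s ≤ Real.exp (s * (2 * L)))
    (h : s * (2 * L) + 2 ≤ p * N / 8) :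
    (N : ℝ) ^ s * (Real.exp D * Real.exp (-(p * ((N - s : ℕ) : ℝ) / 2))) < 1 / 4 := by
  have hsub : ((N - s : ℕ) : ℝ) = N - s := by
    rw [Nat.cast_sub]
    have : (s : ℝ) ≤ N := by linarith [Nat.cast_nonneg (α := ℝ) s]
    exact_mod_cast this
  have h1 : p * N / 4 ≤ p * ((N - s : ℕ) : ℝ) / 2 := by
    rw [hsub]
    nlinarith
  calc _ ≤ Real.exp (s * (2 * L)) * (Real.exp D *
        Real.exp (-(p * ((N - s : ℕ) : ℝ) / 2))) :=
        mul_le_mul_of_nonneg_right hNs (by positivity)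
    _ = Real.exp (s * (2 * L) + (D + -(p * ((N - s : ℕ) : ℝ) / 2))) := by
        rw [Real.exp_add, Real.exp_add]
    _ ≤ Real.exp (-2) := Real.exp_le_exp.2 (by linarith)
    _ < _ := exp_neg_two_lt

/-- Union bound over n-tuples of s-sets and over B. In units of n·(np), the term n d/2 gains 8k and
the moment bound costs 4k - 2. The rest pays for N^(sn) and 2^N, because L ≤ np and N ≤ nL. -/
theorem pow_mul_two_pow_mul_exp_lt {N s n d : ℕ} {k p L : ℝ} (hk : 1 ≤ k) (hL : 3 ≤ L)
    (hn : (0 : ℝ) < n) (hy : L ≤ n * p) (hsk : (s : ℝ) = k - 1)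
    (hNs : (N : ℝ) ^ (s * n) ≤ Real.exp ((s * n : ℕ) * (2 * L))) (hN : (N : ℝ) ≤ n * L)
    (hd : 16 * k * (n * p) ≤ d) :
    ((N : ℝ) ^ s) ^ n * 2 ^ N * (2 * (Real.exp (-(n * d / 2)) *
      Real.exp (2 * p * (n * ((2 * s * n + n : ℕ) : ℝ))))) < 1 / 4 := by
  have h2 : (2 : ℝ) ^ N ≤ Real.exp N := by
    rw [← mul_one (N : ℝ), Real.exp_nat_mul]
    exact pow_le_pow_left₀ (by norm_num) (by linarith [Real.add_one_le_exp (1 : ℝ)]) N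
  have h3 : (2 : ℝ) ≤ Real.exp 1 := by linarith [Real.add_one_le_exp (1 : ℝ)]
  have h4 : 2 * p * (n * ((2 * s * n + n : ℕ) : ℝ)) = n * (2 * (2 * k - 1) * (n * p)) := by
    push_cast
    rw [hsk]
    ring
  have h6 : (n : ℝ) * (16 * k * (n * p)) ≤ n * d := mul_le_mul_of_nonneg_left hd hn.le
  have h7 : (n : ℝ) * (k * L) ≤ n * (k * (n * p)) :=
    mul_le_mul_of_nonneg_left (mul_le_mul_of_nonneg_left hy (by linarith)) hn.le
  have hn1 : (1 : ℝ) ≤ n := by exact_mod_cast (Nat.cast_pos.1 hn)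
  have h8 : 3 ≤ (n : ℝ) * L := by nlinarith
  have h9 : (n : ℝ) * L ≤ n * (k * L) :=
    mul_le_mul_of_nonneg_left (by nlinarith) hn.le
  have h10 : 0 ≤ (n : ℝ) * (n * p) := mul_nonneg hn.le (by linarith)
  calc _ ≤ Real.exp ((s * n : ℕ) * (2 * L)) * Real.exp N * (Real.exp 1 *
        (Real.exp (-(n * d / 2)) * Real.exp (2 * p * (n * ((2 * s * n + n : ℕ) : ℝ))))) := by
        rw [← pow_mul]
        gcongr
    _ = Real.exp ((s * n : ℕ) * (2 * L) + N +
        (1 + (-(n * d / 2) + n * (2 * (2 * k - 1) * (n * p))))) := by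
        rw [h4]
        simp only [Real.exp_add]
    _ ≤ Real.exp (-2) := by
        refine Real.exp_le_exp.2 ?_
        push_cast
        rw [hsk]
        linarith
    _ < _ := exp_neg_two_lt

/-- Here p is the edge probability itself, not its s-th power. Both n^k and p^(k choose 2) are
k/2-th powers, of n² and p^(k-1), and n² p^(k-1) ≤ u n L. -/
theorem pow_mul_pow_choose_two_le {k : ℕ} {A n L p u : ℝ} (hA : 0 ≤ A) (hn : 0 < n) (hL : 0 ≤ L)
    (hp : 0 ≤ p) (hu : 0 ≤ u) (h : n * p ^ (k - 1) ≤ u * L) :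
    (A * n) ^ k * p ^ (k.choose 2) ≤
      A ^ k * u ^ ((k : ℝ) / 2) * (n * L) ^ ((k : ℝ) / 2) := by
  have h1 : p ^ (k.choose 2) = (p ^ (k - 1)) ^ ((k : ℝ) / 2) := by
    rw [← Real.rpow_natCast, ← Real.rpow_natCast, ← Real.rpow_mul hp, Nat.cast_choose_two]
    rcases Nat.eq_zero_or_pos k with rfl | hk
    · simp
    · congr 1
      rw [Nat.cast_sub hk]
      push_cast
      ring
  have h2 : n ^ k = (n * n) ^ ((k : ℝ) / 2) := by
    rw [← sq, ← Real.rpow_natCast n 2, ← Real.rpow_mul hn.le, ← Real.rpow_natCast]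
    congr 1
    push_cast
    ring
  rw [mul_pow, h1, h2, mul_assoc, mul_assoc, ← Real.mul_rpow (by positivity) (by positivity),
    ← Real.mul_rpow hu (by positivity)]
  refine mul_le_mul_of_nonneg_left (Real.rpow_le_rpow (by positivity) ?_ (by positivity))
    (by positivity)
  calc n * n * p ^ (k - 1) = n * (n * p ^ (k - 1)) := by ring
    _ ≤ n * (u * L) := mul_le_mul_of_nonneg_left h hn.le
    _ = _ := by ring

theorem exists_cliqueHypergraph_arrows {k r n : ℕ} (hk : 3 ≤ k) (hr : 2 ≤ r)
    (hn : 1000 * (k : ℝ) ^ 2 * r ≤ Real.log n) :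
    ∃ (V : Type) (_ : Fintype V) (H : UniformHypergraph k V), H.Arrows (tightPath k n) r ∧
      (#H.edges : ℝ) ≤ 2 * ((1000 * (k : ℝ) ^ 2 * r) ^ k * (2 ^ (k - 1)) ^ ((k : ℝ) / 2) *
        ((n : ℝ) * Real.log n) ^ ((k : ℝ) / 2)) := by
  obtain ⟨s, rfl⟩ : ∃ s, k = s + 1 := ⟨k - 1, by omega⟩
  set k := s + 1 with hkdef
  set L := Real.log n with hL
  have hkR : (3 : ℝ) ≤ k := by exact_mod_cast hk
  have hsk : (s : ℝ) = k - 1 := by rw [hkdef]; push_cast; ring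
  have hrR : (2 : ℝ) ≤ r := by exact_mod_cast hr
  have hcr : 1000 * (k : ℝ) ≤ 1000 * (k : ℝ) ^ 2 * r := by nlinarith
  have hL1 : 3000 ≤ L := by linarith
  have hnL : L ≤ n := Real.log_le_self (by positivity)
  have hn0 : (0 : ℝ) < n := by linarith
  have hkn : k < n := by
    have : (k : ℝ) < n := by linarith
    exact_mod_cast this
  obtain ⟨q, hq1, hqle, hqge⟩ := exists_nat_pow_le (s := s) (by omega) (x := n / L)
    (by rw [le_div_iff₀ (by linarith)]; linarith)
  have hqne : NeZero q := ⟨by omega⟩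
  have hq0 : (0 : ℝ) < q := by exact_mod_cast hq1
  set p : ℝ := ((q : ℝ)⁻¹) ^ s with hp
  have hp0 : 0 < p := by positivity
  have hpq : p * (q : ℝ) ^ s = 1 := by
    rw [hp, ← mul_pow, inv_mul_cancel₀ hq0.ne', one_pow]
  set y : ℝ := n * p with hy
  have hyL : L ≤ y := by
    rw [le_div_iff₀ (by linarith)] at hqle
    have := mul_le_mul_of_nonneg_left hqle hp0.le
    calc L = p * ((q : ℝ) ^ s * L) := by rw [← mul_assoc, hpq, one_mul]
      _ ≤ p * n := this
      _ = y := by rw [hy]; ring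
  have hyu : y ≤ 2 ^ s * L := by
    rw [div_le_iff₀ (by linarith)] at hqge
    have := mul_le_mul_of_nonneg_left hqge hp0.le
    calc y = p * n := by rw [hy]; ring
      _ ≤ p * (2 ^ s * (q : ℝ) ^ s * L) := this
      _ = (p * (q : ℝ) ^ s) * (2 ^ s * L) := by ring
      _ = _ := by rw [hpq, one_mul]
  -- This size gives D ≈ 125 k² r y, well above (k r + 1) d ≤ 34 k² r y, as the search demands.
  set N : ℕ := 1000 * k ^ 2 * r * n with hN
  have hNR : (N : ℝ) = 1000 * (k : ℝ) ^ 2 * r * n := by rw [hN]; push_cast; ring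
  have hpN : p * N = 1000 * (k : ℝ) ^ 2 * r * y := by rw [hNR, hy]; ring
  have hNbig : 4 * (k : ℝ) * n ≤ N := by
    rw [hNR]
    exact mul_le_mul_of_nonneg_right (by linarith) hn0.le
  have hkkn : (k : ℝ) * 1 ≤ k * n := mul_le_mul_of_nonneg_left (by linarith) (by linarith)
  have hsN : 2 * (s : ℝ) ≤ N := by linarith
  have hN0 : (0 : ℝ) < N := by
    rw [hNR]; positivity
  set d : ℕ := ⌈16 * (k : ℝ) * y⌉₊ with hd
  have hd1 : 16 * (k : ℝ) * y ≤ d := Nat.le_ceil _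
  have hd2 : (d : ℝ) ≤ 17 * k * y := by
    have := Nat.ceil_lt_add_one (show 0 ≤ 16 * (k : ℝ) * y by positivity)
    have : 1 ≤ (k : ℝ) * y := one_le_mul_of_one_le_of_one_le (by linarith) (by linarith)
    linarith
  set D : ℕ := ⌊p * N / 8⌋₊ with hD
  have hD1 : (D : ℝ) ≤ p * N / 8 := Nat.floor_le (by positivity)
  have hD2 : p * N / 8 < D + 1 := Nat.lt_floor_add_one _
  have hlogN : Real.log N ≤ 2 * L := by
    rw [hNR, Real.log_mul (by positivity) hn0.ne', two_mul]
    refine add_le_add_left (Real.log_le_log (by positivity) ?_) _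
    linarith
  have hNexp : ∀ m : ℕ, (N : ℝ) ^ m ≤ Real.exp (m * (2 * L)) := by
    intro m
    rw [← Real.exp_log (pow_pos hN0 m), Real.log_pow]
    exact Real.exp_le_exp.2 (mul_le_mul_of_nonneg_left hlogN (by positivity))
  have hcardV : Fintype.card (Fin N) = N := Fintype.card_fin N
  have hlow : ((Fintype.card (Fin N) : ℕ) : ℝ) ^ s * (Real.exp D *
      Real.exp (-(p * ((Fintype.card (Fin N) - s : ℕ) : ℝ) / 2))) < 1 / 4 := by
    rw [hcardV]
    refine pow_mul_exp_lt hp0.le hsN hD1 (hNexp s) ?_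
    rw [hpN, hsk]
    have : 1000 * (k : ℝ) * L ≤ 1000 * (k : ℝ) ^ 2 * r * y :=
      mul_le_mul hcr hyL (by linarith) (by positivity)
    have : (3 : ℝ) * L ≤ k * L := mul_le_mul_of_nonneg_right hkR (by linarith)
    linarith
  have hupp : (((Fintype.card (Fin N) : ℕ) : ℝ) ^ s) ^ n * 2 ^ (Fintype.card (Fin N)) *
      (2 * (Real.exp (-(n * d / 2)) *
        Real.exp (2 * p * (n * ((2 * s * n + n : ℕ) : ℝ))))) < 1 / 4 := by
    rw [hcardV]
    refine pow_mul_two_pow_mul_exp_lt (by linarith) (by linarith) hn0 hyL hsk (hNexp (s * n)) ?_ hd1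
    -- N ≤ nL is exactly the assumption that n is large in terms of k and r.
    rw [hNR, mul_comm]
    exact mul_le_mul_of_nonneg_left hn hn0.le
  have hKc : ((Fintype.card (Fin N)).choose k : ℝ) * ((q : ℝ)⁻¹) ^ (k.choose 2) ≤
      (N : ℝ) ^ k * ((q : ℝ)⁻¹) ^ (k.choose 2) := by
    rw [hcardV]
    refine mul_le_mul_of_nonneg_right ?_ (by positivity)
    exact_mod_cast Nat.choose_le_pow _ _
  obtain ⟨f, hf1, hf2, hf3⟩ := exists_zeroGraph (V := Fin N) (by positivity) hKc hlow hupp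
  refine ⟨Fin N, inferInstance, cliqueHypergraph (zeroGraph f) k,
    cliqueHypergraph_arrows_tightPath (by omega) (by omega) (by omega) hf1 ?_ ?_ hf2, ?_⟩
  · have h0 : 1 ≤ (k : ℝ) * r :=
      one_le_mul_of_one_le_of_one_le (by linarith) (by linarith)
    have h1 : ((k : ℝ) * r + 1) * d ≤ 2 * k * r * (17 * k * y) :=
      mul_le_mul (by linarith) hd2 (by positivity) (by positivity)
    have h2 : 1 ≤ (k : ℝ) ^ 2 * r * y :=
      one_le_mul_of_one_le_of_one_le
        (one_le_mul_of_one_le_of_one_le (one_le_pow₀ (by linarith)) (by linarith)) (by linarith)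
    have h3 : (k : ℝ) * (r * d) + d < D := by
      rw [hpN] at hD2
      linarith
    exact_mod_cast h3
  · have h1 : 2 * (s : ℝ) * n + s ≤ N := by
      rw [hsk]
      linarith
    rw [hcardV]
    exact_mod_cast h1
  · refine hf3.trans (mul_le_mul_of_nonneg_left ?_ (by norm_num))
    rw [hNR]
    exact pow_mul_pow_choose_two_le (by positivity) hn0 (by linarith) (by positivity)
      (by positivity) hyu

end UniformHypergraph

theorem theorem1 (k : ℕ) (hk : 3 ≤ k) :
    ∃ C : ℝ, 0 < C ∧ ∀ r : ℕ, 2 ≤ r → ∃ n₀ : ℕ, ∀ n : ℕ, n₀ ≤ n →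
      ∃ m : ℕ, (UniformHypergraph.tightPath k n).sizeRamsey r = (m : ℕ∞) ∧
        (m : ℝ) ≤ C * ((r : ℝ) ^ k * ((n : ℝ) * Real.log (n : ℝ)) ^ ((k : ℝ) / 2)) := by
  have hk0 : (0 : ℝ) < k := by exact_mod_cast (by omega : 0 < k)
  -- The 2 comes from Markov's inequality, the base 1000 k² from N / (r n), and 2^(k-1) from
  -- rounding q down. The threshold n₀ makes log n at least 1000 k² r.
  refine ⟨2 * ((1000 * (k : ℝ) ^ 2) ^ k * (2 ^ (k - 1)) ^ ((k : ℝ) / 2)), by positivity,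
    fun r hr => ⟨⌈Real.exp (1000 * (k : ℝ) ^ 2 * r)⌉₊, fun n hn => ?_⟩⟩
  have hexp : Real.exp (1000 * (k : ℝ) ^ 2 * r) ≤ n := (Nat.le_ceil _).trans (by exact_mod_cast hn)
  obtain ⟨V, hV, H, hH, hcard⟩ := UniformHypergraph.exists_cliqueHypergraph_arrows hk hr
    ((Real.le_log_iff_exp_le ((Real.exp_pos _).trans_le hexp)).2 hexp)
  have hle : (UniformHypergraph.tightPath k n).sizeRamsey r ≤ (H.edges.card : ℕ∞) :=
    sInf_le ⟨V, hV, H, hH, rfl⟩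
  obtain ⟨m, hm⟩ := ENat.ne_top_iff_exists.1 (ne_top_of_le_ne_top (ENat.natCast_ne_top _) hle)
  refine ⟨m, hm.symm, ?_⟩
  rw [← hm] at hle
  have hle' : (m : ℝ) ≤ H.edges.card := by exact_mod_cast hle
  refine hle'.trans (hcard.trans (le_of_eq ?_))
  rw [mul_pow _ (r : ℝ)]
  ring
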